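/- Let $S$ be a compact complex surface (a compact Hausdorff complex manifold of dimension $2$) and let $\mathcal F$ be a holomorphic foliation on $S$ with isolated singularities, given by an open covering $\{U_i\}$ of $S$, holomorphic vector fields $X_i$ on $U_i$ with isolated zeros, and invertible holomorphic functions $g_{ij}$ on $U_i\cap U_j$ with $X_i=g_{ij}X_j$. Let $K_{\mathcal F}$ be its canonical bundle, i.e. the dual of the line bundle $T\mathcal F$ locally generated by the $X_i$, and let $P_m(\mathcal F)=h^0(S,K_{\mathcal F}^{\otimes m})$. Assume that $\mathcal F$ is reduced: at every zero $p$ of a local generator $X_i$, the two eigenvalues of the linear part of $X_i$ at $p$ are not both zero and their quotient, when defined, is not a positive rational number. Assume that $\mathcal F$ is of general type, i.e. its Kodaira dimension $$\mathrm{kod}(\mathcal F)=\limsup_{n\to\infty}\frac{\log P_n(\mathcal F)}{\log n}$$ (with $\log 0=-\infty$) equals $2$. Let $h$ be the height of $\mathcal F$, i.e. the first positive integer such that $K_{\mathcal F}^{\otimes h}$ has $\mathrm{kod}(\mathcal F)+1=3$ holomorphic sections that are algebraically independent over $\mathbb C$ (in the section ring $\bigoplus_{m\ge 0}H^0(S,K_{\mathcal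 F}^{\otimes m})$). Then for every integer $n\ge 0$ $$P_{hn}(\mathcal F)\ \ge\ \binom{n+2}{2}.$$ -/

import Mathlib

open scoped Manifold ContDiff Topology

/-- The model space `ℂ²` of a complex surface. -/
abbrev ComplexPlane : Type := EuclideanSpace ℂ (Fin 2)

section ComplexSurface

variable {S : Type*} [TopologicalSpace S] [ChartedSpace ComplexPlane S]

/-- A complex-valued function on the complex surface `S` is holomorphic on the open set `V`. -/
def IsHolomorphicOn (f : S → ℂ) (V : Set S) : Prop :=
  MDifferentiableOn 𝓘(ℂ, ComplexPlane) 𝓘(ℂ, ℂ) f V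

theorem IsHolomorphicOn.inv {f : S → ℂ} {V : Set S} (hf : IsHolomorphicOn f V)
    (h0 : ∀ p ∈ V, f p ≠ 0) : IsHolomorphicOn (fun p => (f p)⁻¹) V := by
  intro p hp
  have h1 : MDifferentiableAt 𝓘(ℂ, ℂ) 𝓘(ℂ, ℂ) (fun z : ℂ => z⁻¹) (f p) :=
    (differentiableAt_inv (h0 p hp)).mdifferentiableAt
  exact h1.comp_mdifferentiableWithinAt p (hf p hp)

theorem IsHolomorphicOn.pow {f : S → ℂ} {V : Set S} (hf : IsHolomorphicOn f V) (m : ℕ) :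
    IsHolomorphicOn (fun p => f p ^ m) V := by
  intro p hp
  have h1 : MDifferentiableAt 𝓘(ℂ, ℂ) 𝓘(ℂ, ℂ) (fun z : ℂ => z ^ m) (f p) :=
    (differentiableAt_pow m).mdifferentiableAt
  exact h1.comp_mdifferentiableWithinAt p (hf p hp)

variable (S) in
/-- A holomorphic line bundle on `S`, presented by an open covering `U i` and a multiplicative
cocycle of invertible holomorphic functions `t i j` on `U i ∩ U j`. The values of `t i j` outside
`U i ∩ U j` are irrelevant. -/
structure HolomorphicLineBundle where
  /-- The index set of the covering. -/
  ι : Type*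
  /-- The open sets of the covering. -/
  U : ι → TopologicalSpace.Opens S
  cover : ∀ p : S, ∃ i, p ∈ U i
  /-- The transition functions. -/
  t : ι → ι → S → ℂ
  holomorphic_t : ∀ i j, IsHolomorphicOn (t i j) (U i ∩ U j)
  t_ne_zero : ∀ i j, ∀ p ∈ (U i ∩ U j : Set S), t i j p ≠ 0
  cocycle : ∀ i j k, ∀ p ∈ (U i ∩ U j ∩ U k : Set S), t i j p * t j k p = t i k p

namespace HolomorphicLineBundle

/-- The dual line bundle. -/
noncomputable def dual (L : HolomorphicLineBundle S) : HolomorphicLineBundle S where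
  ι := L.ι
  U := L.U
  cover := L.cover
  t i j p := (L.t i j p)⁻¹
  holomorphic_t i j := (L.holomorphic_t i j).inv (L.t_ne_zero i j)
  t_ne_zero i j p hp := inv_ne_zero (L.t_ne_zero i j p hp)
  cocycle i j k p hp := by rw [← mul_inv, L.cocycle i j k p hp]

/-- The tensor power `L^{⊗ m}`. -/
def tensorPow (L : HolomorphicLineBundle S) (m : ℕ) : HolomorphicLineBundle S where
  ι := L.ι
  U := L.U
  cover := L.cover
  t i j p := L.t i j p ^ m
  holomorphic_t i j := (L.holomorphic_t i j).pow m
  t_ne_zero i j p hp := pow_ne_zero m (L.t_ne_zero i j p hp)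
  cocycle i j k p hp := by rw [← mul_pow, L.cocycle i j k p hp]

/-- The space `H⁰(S, L)` of global holomorphic sections: families of holomorphic functions
`f i` on `U i` such that `f i = t i j * f j` on `U i ∩ U j`. -/
def globalSections (L : HolomorphicLineBundle S) : Submodule ℂ (∀ i, L.U i → ℂ) where
  carrier := {f | (∀ i, MDifferentiable 𝓘(ℂ, ComplexPlane) 𝓘(ℂ, ℂ) (f i)) ∧
    ∀ i j p (hi : p ∈ L.U i) (hj : p ∈ L.U j), f i ⟨p, hi⟩ = L.t i j p * f j ⟨p, hj⟩}
  add_mem' {f g} hf hg := by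
    refine ⟨fun i => (hf.1 i).add (hg.1 i), fun i j p hi hj => ?_⟩
    have h1 := hf.2 i j p hi hj
    have h2 := hg.2 i j p hi hj
    simp only [Pi.add_apply, h1, h2]
    ring
  zero_mem' := ⟨fun i => mdifferentiable_const, fun i j p hi hj => by simp⟩
  smul_mem' c f hf := by
    refine ⟨fun i => (hf.1 i).const_smul c, fun i j p hi hj => ?_⟩
    have h1 := hf.2 i j p hi hj
    simp only [Pi.smul_apply, h1, smul_eq_mul]
    ring

/-- `h⁰(S, L)`, the dimension of `H⁰(S, L)`, as an element of `ℕ ∪ {∞}` . -/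
noncomputable def h0 (L : HolomorphicLineBundle S) : ℕ∞ :=
  Cardinal.toENat (Module.rank ℂ L.globalSections)

/-- `H⁰(S, L^{⊗ m})`, all of them inside the same ring of families of functions on the `U i`. -/
def powSections (L : HolomorphicLineBundle S) (m : ℕ) : Submodule ℂ (∀ i, L.U i → ℂ) :=
  (L.tensorPow m).globalSections

instance (L : HolomorphicLineBundle S) : SetLike.GradedMonoid L.powSections where
  one_mem := by
    refine ⟨fun i => mdifferentiable_const, fun i j p hi hj => ?_⟩
    change (1 : ℂ) = L.t i j p ^ 0 * 1
    simp
  mul_mem m n f g hf hg := by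
    refine ⟨fun i => (hf.1 i).mul (hg.1 i), fun i j p hi hj => ?_⟩
    have h1 : f i ⟨p, hi⟩ = L.t i j p ^ m * f j ⟨p, hj⟩ := hf.2 i j p hi hj
    have h2 : g i ⟨p, hi⟩ = L.t i j p ^ n * g j ⟨p, hj⟩ := hg.2 i j p hi hj
    change f i ⟨p, hi⟩ * g i ⟨p, hi⟩ = L.t i j p ^ (m + n) * (f j ⟨p, hj⟩ * g j ⟨p, hj⟩)
    rw [h1, h2, pow_add]
    ring

open scoped DirectSum in
/-- The section ring `⨁ₘ H⁰(S, L^{⊗ m})`, a commutative graded `ℂ`-algebra whose product is the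
product of sections. -/
abbrev SectionRing (L : HolomorphicLineBundle S) : Type _ :=
  ⨁ m : ℕ, L.powSections m

/-- Sections of `L^{⊗ m}` are algebraically independent: they are so, over `ℂ`, as elements
of degree `m` of the section ring of `L`. -/
def AlgIndepSections (L : HolomorphicLineBundle S) {m : ℕ} {κ : Type*}
    (s : κ → L.powSections m) : Prop :=
  AlgebraicIndependent ℂ
    (fun a => (DirectSum.of (fun m => L.powSections m) m (s a) : L.SectionRing))

end HolomorphicLineBundle

variable [IsManifold 𝓘(ℂ, ComplexPlane) ω S]

/-- The vector field `X` (a section of the holomorphic tangent bundle) is holomorphic on `V`. -/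
def IsHolomorphicVectorFieldOn (X : ∀ p : S, TangentSpace 𝓘(ℂ, ComplexPlane) p)
    (V : Set S) : Prop :=
  MDifferentiableOn 𝓘(ℂ, ComplexPlane) (𝓘(ℂ, ComplexPlane).tangent)
    (fun p => (⟨p, X p⟩ : TangentBundle 𝓘(ℂ, ComplexPlane) S)) V

/-- The linear part of the vector field `X` at `p`: the derivative at `p` of the expression of `X`
in the preferred chart at `p`. -/
noncomputable def linearPart (X : ∀ p : S, TangentSpace 𝓘(ℂ, ComplexPlane) p) (p : S) :
    ComplexPlane →ₗ[ℂ] ComplexPlane :=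
  (fderiv ℂ (fun z : ComplexPlane =>
      tangentCoordChange 𝓘(ℂ, ComplexPlane)
        ((extChartAt 𝓘(ℂ, ComplexPlane) p).symm z) p
        ((extChartAt 𝓘(ℂ, ComplexPlane) p).symm z)
        (X ((extChartAt 𝓘(ℂ, ComplexPlane) p).symm z)))
    (extChartAt 𝓘(ℂ, ComplexPlane) p p) : ComplexPlane →L[ℂ] ComplexPlane)

variable (S) in
/-- A holomorphic foliation (with isolated singularities) on the complex surface `S`: an open
covering `U i`, holomorphic vector fields `X i` on `U i` with isolated zeros, and invertible
holomorphic functions `g i j` on `U i ∩ U j` with `X i = g i j • X j` there. The values of `X i`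
outside `U i` and of `g i j` outside `U i ∩ U j` are irrelevant. -/
structure HolomorphicFoliation where
  /-- The index set of the covering. -/
  ι : Type*
  /-- The open sets of the covering. -/
  U : ι → TopologicalSpace.Opens S
  cover : ∀ p : S, ∃ i, p ∈ U i
  /-- The local generators. -/
  X : ι → ∀ p : S, TangentSpace 𝓘(ℂ, ComplexPlane) p
  holomorphic_X : ∀ i, IsHolomorphicVectorFieldOn (X i) (U i)
  isolated_zeros : ∀ i, ∀ p ∈ U i, ∀ᶠ q in 𝓝[≠] p, X i q ≠ 0
  /-- The changes of generator. -/
  g : ι → ι → S → ℂ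
  holomorphic_g : ∀ i j, IsHolomorphicOn (g i j) (U i ∩ U j)
  g_ne_zero : ∀ i j, ∀ p ∈ (U i ∩ U j : Set S), g i j p ≠ 0
  X_eq : ∀ i j, ∀ p ∈ (U i ∩ U j : Set S), X i p = g i j p • X j p

namespace HolomorphicFoliation

theorem g_cocycle (F : HolomorphicFoliation S) (i j k : F.ι) (p : S)
    (hp : p ∈ (F.U i ∩ F.U j ∩ F.U k : Set S)) : F.g i j p * F.g j k p = F.g i k p := by
  obtain ⟨⟨hi, hj⟩, hk⟩ := hp
  have hne : (𝓝[≠] p).NeBot := by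
    by_contra hbot
    have ho : IsOpen ({p} : Set S) := by
      rw [isOpen_singleton_iff_punctured_nhds]
      exact Filter.not_neBot.mp hbot
    have h1 := (chartAt ComplexPlane p).isOpen_image_of_subset_source ho
      (by simp)
    rw [Set.image_singleton] at h1
    exact not_isOpen_singleton _ h1
  have cont : ∀ a b, p ∈ F.U a → p ∈ F.U b → Filter.Tendsto (F.g a b) (𝓝[≠] p) (𝓝 (F.g a b p)) := by
    intro a b ha hb
    have h1 := (F.holomorphic_g a b p ⟨ha, hb⟩).continuousWithinAt
    have h2 := h1.continuousAt (((F.U a).isOpen.inter (F.U b).isOpen).mem_nhds ⟨ha, hb⟩)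
    exact h2.tendsto.mono_left nhdsWithin_le_nhds
  refine tendsto_nhds_unique_of_eventuallyEq ((cont i j hi hj).mul (cont j k hj hk))
    (cont i k hi hk) ?_
  filter_upwards [F.isolated_zeros k p hk, nhdsWithin_le_nhds ((F.U i).isOpen.mem_nhds hi),
    nhdsWithin_le_nhds ((F.U j).isOpen.mem_nhds hj),
    nhdsWithin_le_nhds ((F.U k).isOpen.mem_nhds hk)] with q h0 qi qj qk
  have h1 := F.X_eq i j q ⟨qi, qj⟩
  rw [F.X_eq j k q ⟨qj, qk⟩, smul_smul, F.X_eq i k q ⟨qi, qk⟩] at h1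
  exact (smul_left_injective ℂ h0 h1).symm

/-- The tangent bundle `TF`, the line bundle with local generators `X i`: its sections are
locally `f i • X i`, and `f i • X i = f j • X j` means `f i = (g i j)⁻¹ * f j`. -/
noncomputable def tangentLineBundle (F : HolomorphicFoliation S) : HolomorphicLineBundle S where
  ι := F.ι
  U := F.U
  cover := F.cover
  t i j p := (F.g i j p)⁻¹
  holomorphic_t i j := (F.holomorphic_g i j).inv (F.g_ne_zero i j)
  t_ne_zero i j p hp := inv_ne_zero (F.g_ne_zero i j p hp)
  cocycle i j k p hp := by rw [← mul_inv, F.g_cocycle i j k p hp]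

/-- The canonical bundle `K_F`, dual to the tangent bundle. -/
noncomputable def canonicalBundle (F : HolomorphicFoliation S) : HolomorphicLineBundle S :=
  F.tangentLineBundle.dual

/-- The plurigenera `P_m(F) = h⁰(S, K_F^{⊗ m})`. -/
noncomputable def plurigenus (F : HolomorphicFoliation S) (m : ℕ) : ℕ∞ :=
  (F.canonicalBundle.tensorPow m).h0

/-- `F` is reduced (in Seidenberg's sense): at every singular point, with `a`, `b` the eigenvalues
(with multiplicity) of the linear part of a generating vector field, `a` and `b` are not both zero
and their quotient, when defined, is not a positive rational number. -/
def IsReduced (F : HolomorphicFoliation S) : Prop :=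
  ∀ i, ∀ p ∈ F.U i, F.X i p = 0 →
    ∀ a b : ℂ, (linearPart (F.X i) p).charpoly.roots = {a, b} →
      ¬ (a = 0 ∧ b = 0) ∧ (b ≠ 0 → ∀ r : ℚ, 0 < r → a / b ≠ (r : ℂ))

/-- The Kodaira dimension `limsup log P_n(F) / log n` of a reduced foliation `F`, with the
convention `log 0 = -∞`. (For a foliation that is not reduced one passes to a reduced model.) -/
noncomputable def kodairaDimension (F : HolomorphicFoliation S) (_ : F.IsReduced) : EReal :=
  Filter.limsup
    (fun n : ℕ => ENNReal.log (F.plurigenus n : ENNReal) / ((Real.log n : ℝ) : EReal))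
    Filter.atTop

/-- A reduced foliation is of general type if its Kodaira dimension is `2`. -/
def IsGeneralType (F : HolomorphicFoliation S) (hF : F.IsReduced) : Prop :=
  F.kodairaDimension hF = 2

/-- `h` is the height of the reduced foliation `F`: the Kodaira dimension of `F` is a natural
number `k`, and `h` is the first positive integer such that `K_F^{⊗ h}` has `k + 1` algebraically
independent holomorphic sections. -/
def IsHeight (F : HolomorphicFoliation S) (hF : F.IsReduced) (h : ℕ) : Prop :=
  ∃ k : ℕ, F.kodairaDimension hF = (k : EReal) ∧
    IsLeast {m : ℕ | 0 < m ∧ ∃ s : Fin (k + 1) → F.canonicalBundle.powSections m,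
      F.canonicalBundle.AlgIndepSections s} h

end HolomorphicFoliation

end ComplexSurface

/-! Height `h` and Kodaira dimension 2 provide three algebraically independent sections of degree
`h`. Algebraic independence says that evaluating polynomials at them is injective into the section
ring, so it carries the monomials of degree `n` to linearly independent elements. These all lie in
the single graded piece of degree `h * n`, whose dimension is the plurigenus, and there are `(n +
2).choose 2` of them. The algebra works for any graded family of submodules:
`exists_of_eq_multiset_prod_map` locates the degree of a monomial and `card_sym_le_toENat_rank`
counts. -/

open scoped DirectSum in
/-- A monomial in homogeneous elements of the same degree `h` is homogeneous, of degree `h` times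
the number of its factors. -/
theorem exists_of_eq_multiset_prod_map {A κ : Type*} [CommRing A] [Algebra ℂ A]
    (M : ℕ → Submodule ℂ A) [SetLike.GradedMonoid M] {h : ℕ} (s : κ → M h) (σ : Multiset κ) :
    ∃ v : M (h * σ.card), (DirectSum.of (fun m => M m) (h * σ.card) v : ⨁ m, M m) =
      (σ.map fun a => (DirectSum.of (fun m => M m) h (s a) : ⨁ m, M m)).prod := by
  -- The degree occurs in the type of `v`; freeing it as `m` lets the induction use `h + h * σ.card`
  -- without casts.
  suffices H : ∀ m, m = h * σ.card → ∃ v : M m, (DirectSum.of (fun m => M m) m v : ⨁ m, M m) =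
      (σ.map fun a => (DirectSum.of (fun m => M m) h (s a) : ⨁ m, M m)).prod from H _ rfl
  induction σ using Multiset.induction_on with
  | empty =>
    rintro m rfl
    exact ⟨⟨1, by simpa using SetLike.GradedOne.one_mem (A := M)⟩,
      -- Degrees `h * 0` and `0` index different types, so the two units are compared as pairs
      -- (degree, element).
      DirectSum.of_eq_of_gradedMonoid_eq (Sigma.subtype_ext (Nat.mul_zero h) rfl)⟩
  | cons a σ ih =>
    obtain ⟨v, hv⟩ := ih _ rfl
    intro m hm
    obtain rfl : m = h + h * σ.card := by rw [hm, Multiset.card_cons]; ring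
    exact ⟨GradedMonoid.GMul.mul (A := fun m => M m) (s a) v, by
      rw [Multiset.map_cons, Multiset.prod_cons, ← hv, DirectSum.of_mul_of]⟩

open scoped DirectSum in
/-- If `κ` indexes algebraically independent homogeneous elements of degree `h`, the monomials of
degree `n` in them are linearly independent elements of degree `h * n`. -/
theorem card_sym_le_toENat_rank {A κ : Type*} [CommRing A] [Algebra ℂ A] [Fintype κ]
    [DecidableEq κ] (M : ℕ → Submodule ℂ A) [SetLike.GradedMonoid M] {h : ℕ} (s : κ → M h)
    (hs : AlgebraicIndependent ℂ
      (fun a => (DirectSum.of (fun m => M m) h (s a) : ⨁ m, M m))) (n : ℕ) :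
    (Fintype.card (Sym κ n) : ℕ∞) ≤ Cardinal.toENat (Module.rank ℂ (M (h * n))) := by
  have hmon : ∀ σ : Sym κ n, ∃ v : M (h * n),
      (DirectSum.of (fun m => M m) (h * n) v : ⨁ m, M m) =
        ((σ : Multiset κ).map fun a => (DirectSum.of (fun m => M m) h (s a) : ⨁ m, M m)).prod := by
    rintro ⟨σ, rfl⟩
    exact exists_of_eq_multiset_prod_map M s σ
  choose v hv using hmon
  -- A multiset of size `n` is recorded by its exponent vector, so distinct multisets give distinct
  -- basis monomials.
  have hinj : Function.Injective fun σ : Sym κ n => Multiset.toFinsupp (σ : Multiset κ) :=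
    Multiset.toFinsupp.injective.comp Subtype.val_injective
  have hlin := ((MvPolynomial.basisMonomials κ ℂ).linearIndependent.comp _ hinj).map_injOn
    (MvPolynomial.aeval fun a => (DirectSum.of (fun m => M m) h (s a) : ⨁ m, M m)).toLinearMap
    (Function.Injective.injOn hs)
  have hv_lin : LinearIndependent ℂ v := by
    -- Independence may be tested after the linear inclusion of the graded piece into the direct
    -- sum, where the `v σ` become the evaluated monomials.
    refine LinearIndependent.of_comp (DirectSum.lof ℂ ℕ (fun m => M m) (h * n)) ?_
    have hcomp : DirectSum.lof ℂ ℕ (fun m => M m) (h * n) ∘ v =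
        MvPolynomial.aeval (fun a => (DirectSum.of (fun m => M m) h (s a) : ⨁ m, M m)) ∘
          MvPolynomial.basisMonomials κ ℂ ∘
            fun σ : Sym κ n => Multiset.toFinsupp (σ : Multiset κ) := by
      funext σ
      have h1 := hv σ
      rw [Finset.prod_multiset_map_count] at h1
      simp only [Function.comp_apply, MvPolynomial.coe_basisMonomials, MvPolynomial.aeval_monomial,
        map_one, one_mul]
      exact h1
    rw [hcomp]
    exact hlin
  have hcard := hv_lin.cardinal_lift_le_rank
  have h2 := Cardinal.toENat.monotone' hcard
  simpa using h2

theorem mainTheorem7 {S : Type*} [TopologicalSpace S] [T2Space S] [CompactSpace S]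
    [ChartedSpace ComplexPlane S] [IsManifold 𝓘(ℂ, ComplexPlane) ω S]
    (F : HolomorphicFoliation S) (hred : F.IsReduced) (hgen : F.IsGeneralType hred)
    (h : ℕ) (hh : F.IsHeight hred h) (n : ℕ) :
    ((n + 2).choose 2 : ℕ∞) ≤ F.plurigenus (h * n) := by
  obtain ⟨k, hk, ⟨-, s, hs⟩, -⟩ := hh
  obtain rfl : k = 2 := by
    rw [show F.kodairaDimension hred = 2 from hgen] at hk
    exact_mod_cast hk.symm
  -- Stars and bars: multisets of size `n` from three letters number `(n + 2).choose n`, which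
  -- equals `(n + 2).choose 2` by symmetry.
  have hcard : Fintype.card (Sym (Fin (2 + 1)) n) = (n + 2).choose 2 := by
    rw [Sym.card_sym_eq_choose, Fintype.card_fin, show 2 + 1 + n - 1 = n + 2 by omega,
      Nat.choose_symm_add]
  rw [← hcard]
  exact card_sym_le_toENat_rank F.canonicalBundle.powSections s hs n
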